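/- Let $d,k\in\mathbb N$, $\mathcal X=\{1,\dots,k\}$, $T>0$, $r:\mathcal X\to[0,\infty)$, $\sigma(i)\in\mathbb R^{d\times d}$ and $a(i)=\sigma(i)\sigma(i)^{\top}$ for $i\in\mathcal X$, and let $\Lambda=(\lambda_{ij})$ be a $k\times k$ transition rate matrix ($\lambda_{ij}\ge 0$ for $i\ne j$, zero row sums). For functions $f(t,s,i)$ put $$\mathbb Lf(t,s,i)=r(i)\sum_{l=1}^d s_l\frac{\partial f}{\partial s_l}(t,s,i)+\frac12\sum_{l,l'=1}^d a_{ll'}(i)s_ls_{l'}\frac{\partial^2 f}{\partial s_l\partial s_{l'}}(t,s,i)-r(i)f(t,s,i)+\sum_{j=1}^k\lambda_{ij}f(t,s,j).$$ Let $R=\prod_{l=1}^d(s_l^b,s_l^u)$ with $0\le s_l^b<s_l^u$, and $\Gamma=\partial R\cap(0,\infty)^d$. Call $f$ regular if it belongs to $$C\big([0,T]\times(\overline R\cap(0,\infty)^d)\times\mathcal X\big)\cap C^{1,2}\big((0,T)\times R\times\mathcal X\big).$$ Let $\mathcal K$ be a real-valued function of $s$, and let $v,w$ be regular functions of at most linear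 growth in $s$ (that is, $|f(t,s,i)|\le c\,(1+\sum_l|s_l|)$ on $[0,T]\times(\overline R\cap(0,\infty)^d)\times\mathcal X$ for some constant $c$) such that, for $f=v$ and $f=w$, $$\frac{\partial f}{\partial t}+\mathbb Lf=0\ \text{ on }(0,T)\times R\times\mathcal X,\qquad f(T,s,i)=\mathcal K(s)\ \text{ for } s\in R,\ i\in\mathcal X.$$ Let $y_1,\dots,y_d$ be regular functions with $\frac{\partial y_l}{\partial t}+\mathbb Ly_l\le 0$ on $(0,T)\times R\times\mathcal X$, let $C_1,\dots,C_d\ge 0$, and assume that $y=\sum_{l=1}^dC_ly_l$ is strictly positive on $[0,T]\times R\times\mathcal X$. Then for all $(t,s,i)\in(0,T)\times R\times\mathcal X$ $$|v(t,s,i)-w(t,s,i)|\le\left(\sup_{(t',s',i')\in(t,T)\times\Gamma\times\mathcal X}\frac{|v(t',s',i')-w(t',s',i')|}{y(t',s',i')}\right)y(t,s,i),$$ where the supremum is taken in $[0,\infty]$; where $y$ vanishes on $\Gamma$, the quotient is read as $a/0=\infty$ for $a>0$ and $0/0=0$. -/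

import Mathlib

open Set
open scoped ENNReal

noncomputable section

namespace RegimeSwitching

/-- Parameters of the regime switching market with `d` assets and regimes `Fin k`: interest rates
`r i ≥ 0`, volatility matrices `sigma i`, and the transition rate matrix `rate` of a Markov chain
(non-negative off-diagonal entries, zero row sums). -/
structure Model (d k : ℕ) where
  r : Fin k → ℝ
  r_nonneg : ∀ i, 0 ≤ r i
  sigma : Fin k → Matrix (Fin d) (Fin d) ℝ
  rate : Matrix (Fin k) (Fin k) ℝ
  rate_nonneg : ∀ i j, i ≠ j → 0 ≤ rate i j
  rate_sum : ∀ i, ∑ j, rate i j = 0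

/-- The diffusion matrix `a(i) = σ(i) σ(i)ᵀ`. -/
def Model.a {d k : ℕ} (m : Model d k) (i : Fin k) (l l' : Fin d) : ℝ :=
  ∑ j, m.sigma i l j * m.sigma i l' j

/-- The partial derivative of `g` in the `l`-th coordinate (for differentiable `g`). -/
def partialDeriv {d : ℕ} (l : Fin d) (g : (Fin d → ℝ) → ℝ) (s : Fin d → ℝ) : ℝ :=
  fderiv ℝ g s (Pi.single l 1)

/-- The operator `𝕃` of the system. -/
def Model.L {d k : ℕ} (m : Model d k) (f : ℝ → (Fin d → ℝ) → Fin k → ℝ)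
    (t : ℝ) (s : Fin d → ℝ) (i : Fin k) : ℝ :=
  m.r i * ∑ l, s l * partialDeriv l (fun x => f t x i) s
    + 1 / 2 * ∑ l, ∑ l', m.a i l l' * s l * s l' *
        partialDeriv l (partialDeriv l' (fun x => f t x i)) s
    - m.r i * f t s i
    + ∑ j, m.rate i j * f t s j

/-- The parabolic expression `∂f/∂t + 𝕃f` at `(t, s, i)`. -/
def Model.parabolic {d k : ℕ} (m : Model d k) (f : ℝ → (Fin d → ℝ) → Fin k → ℝ)
    (t : ℝ) (s : Fin d → ℝ) (i : Fin k) : ℝ :=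
  deriv (fun τ => f τ s i) t + m.L f t s i

/-- The open positive orthant `(0, ∞)^d`. -/
def orthant (d : ℕ) : Set (Fin d → ℝ) := {s | ∀ l, 0 < s l}

/-- The open box `R = ∏ (s^b_l, s^u_l)`. -/
def box {d : ℕ} (sb su : Fin d → ℝ) : Set (Fin d → ℝ) :=
  Set.pi Set.univ fun l => Ioo (sb l) (su l)

/-- The boundary part `Γ = ∂R ∩ (0, ∞)^d`. -/
def boxBoundary {d : ℕ} (sb su : Fin d → ℝ) : Set (Fin d → ℝ) :=
  frontier (box sb su) ∩ orthant d

/-- `f` belongs to `C([0,T] × (closure U ∩ (0,∞)^d) × 𝒳) ∩ C^{1,2}((0,T) × U × 𝒳)`. -/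
structure IsClassical {d k : ℕ} (T : ℝ) (U : Set (Fin d → ℝ))
    (f : ℝ → (Fin d → ℝ) → Fin k → ℝ) : Prop where
  continuousOn : ∀ i, ContinuousOn (fun p : ℝ × (Fin d → ℝ) => f p.1 p.2 i)
    (Icc 0 T ×ˢ (closure U ∩ orthant d))
  differentiable_time : ∀ i, ∀ t ∈ Ioo 0 T, ∀ s ∈ U, DifferentiableAt ℝ (fun τ => f τ s i) t
  contDiff_space : ∀ i, ∀ t ∈ Ioo 0 T, ContDiffOn ℝ 2 (fun s => f t s i) U
  continuousOn_time : ∀ i, ContinuousOn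
    (fun p : ℝ × (Fin d → ℝ) => deriv (fun τ => f τ p.2 i) p.1) (Ioo 0 T ×ˢ U)
  continuousOn_space : ∀ i l, ContinuousOn
    (fun p : ℝ × (Fin d → ℝ) => partialDeriv l (fun s => f p.1 s i) p.2) (Ioo 0 T ×ˢ U)
  continuousOn_space₂ : ∀ i l l', ContinuousOn
    (fun p : ℝ × (Fin d → ℝ) => partialDeriv l (partialDeriv l' (fun s => f p.1 s i)) p.2)
    (Ioo 0 T ×ˢ U)

/-- At most linear growth in the space variable on `[0,T] × (closure U ∩ (0,∞)^d) × 𝒳`. -/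
def LinearGrowth {d k : ℕ} (T : ℝ) (U : Set (Fin d → ℝ))
    (f : ℝ → (Fin d → ℝ) → Fin k → ℝ) : Prop :=
  ∃ c : ℝ, ∀ t ∈ Icc 0 T, ∀ s ∈ closure U ∩ orthant d, ∀ i, |f t s i| ≤ c * (1 + ∑ l, |s l|)

/-- `f` is a classical solution, of at most linear growth, of the system `∂f/∂t + 𝕃f = 0` on
`(0,T) × U × 𝒳` with terminal data `f(T, s, i) = K s` for `s ∈ U`. No condition is imposed on the
boundary of `U`. -/
structure Model.IsSolution {d k : ℕ} (m : Model d k) (T : ℝ) (U : Set (Fin d → ℝ))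
    (K : (Fin d → ℝ) → ℝ) (f : ℝ → (Fin d → ℝ) → Fin k → ℝ) : Prop where
  classical : IsClassical T U f
  growth : LinearGrowth T U f
  pde : ∀ t ∈ Ioo 0 T, ∀ s ∈ U, ∀ i, m.parabolic f t s i = 0
  terminal : ∀ s ∈ U, ∀ i, f T s i = K s

end RegimeSwitching

end

/-! Put `u = v - w` and let `M` be the supremum. If `M = ∞` there is nothing to prove. Otherwise `M
* y ± u` are supersolutions, nonnegative at time `T` and on `Γ`, and a minimum principle makes them
nonnegative on the whole box.

The difficulty is that the closure of the box may meet the coordinate hyperplanes, where no boundary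
values are given and continuity may fail. There a supersolution `z ≥ -B` is perturbed to `z + ε *
barrier`. The logarithmic barrier tends to infinity at the hyperplanes and `parabolic_barrier` makes
it a strict supersolution, so a negative value would force a negative minimum, attained on a compact
set away from the hyperplanes. At that minimum `IsSmoothAt.parabolic_nonneg` contradicts strictness;
then `ε → 0` (`nonneg_of_parabolic_nonpos`). -/

open Filter Topology

namespace RegimeSwitching

variable {d k : ℕ}

/-! ### Calculus of first and second partial derivatives -/

section PartialDeriv

variable {g g₁ g₂ : (Fin d → ℝ) → ℝ} {s : Fin d → ℝ}

theorem contDiffAt_partialDeriv (hg : ContDiffAt ℝ 2 g s) (l : Fin d) :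
    ContDiffAt ℝ 1 (partialDeriv l g) s :=
  (hg.fderiv_right (m := 1) (by norm_num)).clm_apply contDiffAt_const

/-- Second-order rules differentiate a first-order rule, which must therefore hold on a
neighbourhood. -/
theorem eventually_differentiableAt (hg : ContDiffAt ℝ 2 g s) :
    ∀ᶠ x in 𝓝 s, DifferentiableAt ℝ g x := by
  filter_upwards [hg.eventually (by simp)] with x hx
  exact hx.differentiableAt (by norm_num)

theorem partialDeriv_add (h₁ : DifferentiableAt ℝ g₁ s) (h₂ : DifferentiableAt ℝ g₂ s)
    (l : Fin d) :
    partialDeriv l (fun x => g₁ x + g₂ x) s = partialDeriv l g₁ s + partialDeriv l g₂ s := by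
  simp only [partialDeriv]
  rw [fderiv_fun_add h₁ h₂]
  rfl

theorem partialDeriv_const_mul (h : DifferentiableAt ℝ g s) (c : ℝ) (l : Fin d) :
    partialDeriv l (fun x => c * g x) s = c * partialDeriv l g s := by
  simp only [partialDeriv]
  rw [fderiv_const_mul h]
  rfl

theorem partialDeriv_congr (h : g₁ =ᶠ[𝓝 s] g₂) (l : Fin d) :
    partialDeriv l g₁ s = partialDeriv l g₂ s := by
  simp only [partialDeriv, h.fderiv_eq]

theorem partialDeriv_partialDeriv_add (h₁ : ContDiffAt ℝ 2 g₁ s) (h₂ : ContDiffAt ℝ 2 g₂ s)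
    (l l' : Fin d) :
    partialDeriv l (partialDeriv l' (fun x => g₁ x + g₂ x)) s =
      partialDeriv l (partialDeriv l' g₁) s + partialDeriv l (partialDeriv l' g₂) s := by
  rw [← partialDeriv_add ((contDiffAt_partialDeriv h₁ l').differentiableAt (by norm_num))
    ((contDiffAt_partialDeriv h₂ l').differentiableAt (by norm_num))]
  apply partialDeriv_congr
  filter_upwards [eventually_differentiableAt h₁, eventually_differentiableAt h₂] with x hx₁ hx₂
  exact partialDeriv_add hx₁ hx₂ l'

theorem partialDeriv_partialDeriv_const_mul (h : ContDiffAt ℝ 2 g s) (c : ℝ) (l l' : Fin d) :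
    partialDeriv l (partialDeriv l' (fun x => c * g x)) s =
      c * partialDeriv l (partialDeriv l' g) s := by
  rw [← partialDeriv_const_mul ((contDiffAt_partialDeriv h l').differentiableAt (by norm_num))]
  apply partialDeriv_congr
  filter_upwards [eventually_differentiableAt h] with x hx
  exact partialDeriv_const_mul hx c l'

theorem partialDeriv_partialDeriv_eq (hg : ContDiffAt ℝ 2 g s) (l l' : Fin d) :
    partialDeriv l (partialDeriv l' g) s =
      fderiv ℝ (fderiv ℝ g) s (Pi.single l 1) (Pi.single l' 1) := by
  have h : DifferentiableAt ℝ (fderiv ℝ g) s :=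
    (hg.fderiv_right (m := 1) (by norm_num)).differentiableAt (by norm_num)
  have h' := h.hasFDerivAt.clm_apply (hasFDerivAt_const (Pi.single l' (1 : ℝ) : Fin d → ℝ) s)
  change fderiv ℝ (fun x => fderiv ℝ g x (Pi.single l' 1)) s (Pi.single l 1) = _
  rw [h'.fderiv]
  simp

theorem sum_partialDeriv_partialDeriv (hg : ContDiffAt ℝ 2 g s) (ξ : Fin d → ℝ) :
    ∑ l, ∑ l', ξ l * ξ l' * partialDeriv l (partialDeriv l' g) s =
      fderiv ℝ (fderiv ℝ g) s ξ ξ := by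
  have hξ : ξ = ∑ l, ξ l • (Pi.single l 1 : Fin d → ℝ) := by
    ext j
    simp [Finset.sum_apply, Pi.single_apply]
  conv_rhs => rw [hξ]
  simp only [map_sum, _root_.sum_apply, map_smul, _root_.smul_apply,
    smul_eq_mul, partialDeriv_partialDeriv_eq hg]
  rw [Finset.sum_comm]
  refine Finset.sum_congr rfl fun l _ => ?_
  rw [Finset.mul_sum]
  refine Finset.sum_congr rfl fun l' _ => ?_
  ring

end PartialDeriv

/-! ### Necessary conditions at a minimum -/

/-- Necessary second order condition at a local minimum on the line. -/
theorem deriv_deriv_nonneg_of_isLocalMin {q : ℝ → ℝ} {x : ℝ} (h : IsLocalMin q x)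
    (hq : ContinuousAt q x) : 0 ≤ deriv (deriv q) x := by
  by_contra! hneg
  -- A negative second derivative would make `x` a local maximum too, hence `q` locally constant.
  have hmax := isLocalMax_of_deriv_deriv_neg hneg h.deriv_eq_zero hq
  have heq : q =ᶠ[𝓝 x] fun _ => q x := by
    filter_upwards [h, hmax] with z h₁ h₂ using le_antisymm h₂ h₁
  have : deriv (deriv q) x = 0 := by
    rw [heq.deriv.deriv_eq]
    simp
  linarith

/-- Necessary second order condition at a local minimum in space. -/
theorem fderiv_fderiv_nonneg_of_isLocalMin {E : Type*} [NormedAddCommGroup E] [NormedSpace ℝ E]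
    {g : E → ℝ} {s : E} (hg : ContDiffAt ℝ 2 g s) (h : IsLocalMin g s) (ξ : E) :
    0 ≤ fderiv ℝ (fderiv ℝ g) s ξ ξ := by
  have hline : ∀ τ : ℝ, HasDerivAt (fun τ : ℝ => s + τ • ξ) ξ τ := fun τ => by
    simpa using ((hasDerivAt_id τ).smul_const ξ).const_add s
  have hcont : Tendsto (fun τ : ℝ => s + τ • ξ) (𝓝 0) (𝓝 s) := by
    simpa using (hline 0).continuousAt.tendsto
  have hs : s + (0 : ℝ) • ξ = s := by simp
  have hfirst : deriv (fun τ : ℝ => g (s + τ • ξ)) =ᶠ[𝓝 0]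
      fun τ => fderiv ℝ g (s + τ • ξ) ξ := by
    have : ∀ᶠ x in 𝓝 s, DifferentiableAt ℝ g x := by
      filter_upwards [hg.eventually (by simp)] with x hx
      exact hx.differentiableAt (by norm_num)
    filter_upwards [hcont.eventually this] with τ hτ
    exact (hτ.hasFDerivAt.comp_hasDerivAt τ (hline τ)).deriv
  have hd : DifferentiableAt ℝ (fderiv ℝ g) s :=
    (hg.fderiv_right (m := 1) (by norm_num)).differentiableAt (by norm_num)
  have hsecond : HasDerivAt (fun τ : ℝ => fderiv ℝ g (s + τ • ξ) ξ)
      (fderiv ℝ (fderiv ℝ g) s ξ ξ) 0 := by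
    have h₁ : HasDerivAt (fun τ : ℝ => fderiv ℝ g (s + τ • ξ)) (fderiv ℝ (fderiv ℝ g) s ξ) 0 :=
      hd.hasFDerivAt.comp_hasDerivAt_of_eq (0 : ℝ) (hline 0) hs.symm
    simpa using h₁.clm_apply (hasDerivAt_const (0 : ℝ) ξ)
  have hmin : IsLocalMin (fun τ : ℝ => g (s + τ • ξ)) 0 := by
    filter_upwards [hcont.eventually h] with τ hτ
    rwa [hs]
  have hc : ContinuousAt (fun τ : ℝ => g (s + τ • ξ)) 0 := by
    refine ContinuousAt.comp (g := g) ?_ (hline 0).continuousAt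
    rw [hs]
    exact hg.continuousAt
  have := deriv_deriv_nonneg_of_isLocalMin hmin hc
  rwa [hfirst.deriv_eq, hsecond.deriv] at this

/-- A right minimum has non-negative derivative. -/
theorem deriv_nonneg_of_le_right {q : ℝ → ℝ} {t T : ℝ} (htT : t < T)
    (hq : DifferentiableAt ℝ q t) (h : ∀ τ ∈ Ioo t T, q t ≤ q τ) : 0 ≤ deriv q t := by
  have hs : Tendsto (slope q t) (𝓝[>] t) (𝓝 (deriv q t)) :=
    (hasDerivAt_iff_tendsto_slope.1 hq.hasDerivAt).mono_left
      (nhdsWithin_mono _ fun x hx => (ne_of_gt hx : x ≠ t))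
  refine ge_of_tendsto hs ?_
  filter_upwards [Ioo_mem_nhdsGT htT] with τ hτ
  rw [slope_def_field]
  exact div_nonneg (sub_nonneg.2 (h τ hτ)) (sub_nonneg.2 hτ.1.le)

/-! ### Linearity and sign of the parabolic operator -/

/-- Differentiability of `f` at `(t, s)` in the sense needed for `Model.parabolic`. -/
structure IsSmoothAt (f : ℝ → (Fin d → ℝ) → Fin k → ℝ) (t : ℝ) (s : Fin d → ℝ) : Prop where
  time : ∀ i, DifferentiableAt ℝ (fun τ => f τ s i) t
  space : ∀ i, ContDiffAt ℝ 2 (fun x => f t x i) s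

section IsSmoothAt

variable {f g : ℝ → (Fin d → ℝ) → Fin k → ℝ} {t : ℝ} {s : Fin d → ℝ}

theorem IsClassical.isSmoothAt {T : ℝ} {U : Set (Fin d → ℝ)} (hf : IsClassical T U f)
    (hU : IsOpen U) (ht : t ∈ Ioo 0 T) (hs : s ∈ U) : IsSmoothAt f t s where
  time i := hf.differentiable_time i t ht s hs
  space i := (hf.contDiff_space i t ht).contDiffAt (hU.mem_nhds hs)

theorem IsSmoothAt.add (hf : IsSmoothAt f t s) (hg : IsSmoothAt g t s) :
    IsSmoothAt (fun t s i => f t s i + g t s i) t s where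
  time i := (hf.time i).add (hg.time i)
  space i := (hf.space i).add (hg.space i)

theorem IsSmoothAt.const_mul (hf : IsSmoothAt f t s) (c : ℝ) :
    IsSmoothAt (fun t s i => c * f t s i) t s where
  time i := (hf.time i).const_mul c
  space i := contDiffAt_const.mul (hf.space i)

theorem IsSmoothAt.parabolic_add (m : Model d k) (hf : IsSmoothAt f t s) (hg : IsSmoothAt g t s)
    (i : Fin k) :
    m.parabolic (fun t s i => f t s i + g t s i) t s i =
      m.parabolic f t s i + m.parabolic g t s i := by
  simp only [Model.parabolic, Model.L]
  rw [deriv_fun_add (hf.time i) (hg.time i)]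
  simp only [partialDeriv_add ((hf.space i).differentiableAt (by norm_num))
    ((hg.space i).differentiableAt (by norm_num)),
    partialDeriv_partialDeriv_add (hf.space i) (hg.space i), mul_add, Finset.sum_add_distrib]
  ring

theorem IsSmoothAt.parabolic_const_mul (m : Model d k) (hf : IsSmoothAt f t s) (c : ℝ)
    (i : Fin k) :
    m.parabolic (fun t s i => c * f t s i) t s i = c * m.parabolic f t s i := by
  simp only [Model.parabolic, Model.L]
  rw [deriv_const_mul _ (hf.time i)]
  simp only [partialDeriv_const_mul ((hf.space i).differentiableAt (by norm_num)),
    partialDeriv_partialDeriv_const_mul (hf.space i), mul_left_comm _ c, ← Finset.mul_sum]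
  ring

theorem isSmoothAt_sum {ι : Type*} (S : Finset ι) {F : ι → ℝ → (Fin d → ℝ) → Fin k → ℝ}
    (hF : ∀ l ∈ S, IsSmoothAt (F l) t s) : IsSmoothAt (fun t s i => ∑ l ∈ S, F l t s i) t s where
  time i := DifferentiableAt.fun_sum fun l hl => (hF l hl).time i
  space i := ContDiffAt.sum fun l hl => (hF l hl).space i

theorem parabolic_sum_nonpos (m : Model d k) {ι : Type*} (S : Finset ι)
    {F : ι → ℝ → (Fin d → ℝ) → Fin k → ℝ} (hF : ∀ l ∈ S, IsSmoothAt (F l) t s) (i : Fin k)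
    (h : ∀ l ∈ S, m.parabolic (F l) t s i ≤ 0) :
    m.parabolic (fun t s i => ∑ l ∈ S, F l t s i) t s i ≤ 0 := by
  classical
  induction S using Finset.induction_on with
  | empty =>
    have h₀ : ∀ l : Fin d, partialDeriv l (fun _ => (0 : ℝ)) = fun _ => 0 := fun l => by
      funext x
      simp [partialDeriv]
    simp [Model.parabolic, Model.L, h₀]
  | insert b S hb ih =>
    simp only [Finset.sum_insert hb]
    rw [(hF b (Finset.mem_insert_self b S)).parabolic_add m
      (isSmoothAt_sum S fun l hl => hF l (Finset.mem_insert_of_mem hl))]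
    exact add_nonpos (h b (Finset.mem_insert_self b S))
      (ih (fun l hl => hF l (Finset.mem_insert_of_mem hl))
        fun l hl => h l (Finset.mem_insert_of_mem hl))

/-- At a non-positive minimum over regimes, over later times, and locally in space, the parabolic
expression is non-negative. -/
theorem IsSmoothAt.parabolic_nonneg (m : Model d k) (hf : IsSmoothAt f t s) {T : ℝ} (htT : t < T)
    {i : Fin k} (hneg : f t s i ≤ 0) (htime : ∀ τ ∈ Ioo t T, f t s i ≤ f τ s i)
    (hspace : IsLocalMin (fun x => f t x i) s) (hreg : ∀ j, f t s i ≤ f t s j) :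
    0 ≤ m.parabolic f t s i := by
  have h₁ : 0 ≤ deriv (fun τ => f τ s i) t := deriv_nonneg_of_le_right htT (hf.time i) htime
  have h₂ : ∀ l, partialDeriv l (fun x => f t x i) s = 0 := fun l => by
    simp [partialDeriv, hspace.fderiv_eq_zero]
  -- Since `a = σσᵀ`, this is a sum over the columns `j` of `σ` of the Hessian's quadratic form at
  -- the vector `σ_{lj} s_l`.
  have h₃ : 0 ≤ ∑ l, ∑ l', m.a i l l' * s l * s l' *
      partialDeriv l (partialDeriv l' (fun x => f t x i)) s := by
    have : ∑ l, ∑ l', m.a i l l' * s l * s l' *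
        partialDeriv l (partialDeriv l' (fun x => f t x i)) s =
        ∑ j, ∑ l, ∑ l', (m.sigma i l j * s l) * (m.sigma i l' j * s l') *
          partialDeriv l (partialDeriv l' (fun x => f t x i)) s := by
      simp only [Model.a, Finset.sum_mul]
      rw [Finset.sum_comm (s := Finset.univ (α := Fin d))
        (f := fun j l => ∑ l', (m.sigma i l j * s l) * (m.sigma i l' j * s l') *
          partialDeriv l (partialDeriv l' (fun x => f t x i)) s)]
      refine Finset.sum_congr rfl fun l _ => ?_
      rw [Finset.sum_comm]
      refine Finset.sum_congr rfl fun j _ => Finset.sum_congr rfl fun l' _ => ?_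
      ring
    rw [this]
    refine Finset.sum_nonneg fun j _ => ?_
    rw [sum_partialDeriv_partialDeriv (hf.space i) (fun l => m.sigma i l j * s l)]
    exact fderiv_fderiv_nonneg_of_isLocalMin (hf.space i) hspace _
  -- Zero row sums allow subtracting `f t s i`, which removes the diagonal rate of unknown sign.
  have h₄ : 0 ≤ ∑ j, m.rate i j * f t s j := by
    have : ∑ j, m.rate i j * f t s j = ∑ j, m.rate i j * (f t s j - f t s i) := by
      simp only [mul_sub, Finset.sum_sub_distrib, ← Finset.sum_mul, m.rate_sum i]
      ring
    rw [this]
    refine Finset.sum_nonneg fun j _ => ?_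
    rcases eq_or_ne i j with rfl | hij
    · simp
    · exact mul_nonneg (m.rate_nonneg i j hij) (sub_nonneg.2 (hreg j))
  have h₅ : m.r i * f t s i ≤ 0 := mul_nonpos_of_nonneg_of_nonpos (m.r_nonneg i) hneg
  simp only [Model.parabolic, Model.L, h₂, mul_zero, Finset.sum_const_zero]
  linarith

end IsSmoothAt

/-! ### The logarithmic barrier -/

section Barrier

/-- The barrier `∑ₗ (log suₗ - log sₗ) + κ (T - t)`, which blows up at the coordinate
hyperplanes. -/
noncomputable def barrier (su : Fin d → ℝ) (κ T : ℝ) (t : ℝ) (s : Fin d → ℝ) (_ : Fin k) : ℝ :=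
  ∑ l, (Real.log (su l) - Real.log (s l)) + κ * (T - t)

variable {su s : Fin d → ℝ} {κ T t : ℝ}

theorem isSmoothAt_barrier (hs : s ∈ orthant d) :
    IsSmoothAt (barrier (k := k) su κ T) t s where
  time i := by
    unfold barrier
    fun_prop
  space i := by
    unfold barrier
    refine ContDiffAt.add (ContDiffAt.sum fun l _ => contDiffAt_const.sub ?_) contDiffAt_const
    exact (contDiffAt_apply ℝ ℝ l s).log (hs l).ne'

theorem isOpen_orthant : IsOpen (orthant d) := by
  simp only [orthant, ofPred_forall]
  exact isOpen_iInter_of_finite fun l => isOpen_lt continuous_const (continuous_apply l)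

theorem partialDeriv_barrier (hs : s ∈ orthant d) (l : Fin d) (i : Fin k) :
    partialDeriv l (fun x => barrier su κ T t x i) s = -(s l)⁻¹ := by
  have h : HasFDerivAt (fun x : Fin d → ℝ => barrier su κ T t x i)
      (∑ l', -((s l')⁻¹ • ContinuousLinearMap.proj (R := ℝ) (φ := fun _ : Fin d => ℝ) l')) s := by
    unfold barrier
    refine HasFDerivAt.add_const _ (HasFDerivAt.fun_sum fun l' _ => ?_)
    exact ((hasFDerivAt_apply l' s).log (hs l').ne').const_sub _
  simp [partialDeriv, h.fderiv, Pi.single_apply]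

theorem partialDeriv_partialDeriv_barrier (hs : s ∈ orthant d) (l l' : Fin d) (i : Fin k) :
    partialDeriv l (partialDeriv l' (fun x => barrier su κ T t x i)) s =
      if l = l' then (s l ^ 2)⁻¹ else 0 := by
  have heq : partialDeriv l' (fun x => barrier su κ T t x i) =ᶠ[𝓝 s] fun x => -(x l')⁻¹ := by
    filter_upwards [isOpen_orthant.mem_nhds hs] with x hx using partialDeriv_barrier hx l' i
  rw [partialDeriv_congr heq]
  have h := (((hasDerivAt_inv (hs l').ne').comp_hasFDerivAt s
    (hasFDerivAt_apply (𝕜 := ℝ) l' s))).neg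
  have h' : partialDeriv l (fun x : Fin d → ℝ => -(x l')⁻¹) s = _ :=
    congrArg (fun A : (Fin d → ℝ) →L[ℝ] ℝ => A (Pi.single l 1)) h.fderiv
  rw [h']
  by_cases hll : l = l'
  · subst hll
    simp
  · simp [hll, Ne.symm hll]

/-- For `-log s`, the terms `s ∂` and `s² ∂²` are the constants `-1` and `1`, so the degenerate
coefficients cancel the singularity and a large `κ` gives a negative sign. The jump term vanishes
because the barrier ignores the regime. -/
theorem parabolic_barrier (m : Model d k) (hs : s ∈ orthant d) (i : Fin k) :
    m.parabolic (barrier su κ T) t s i =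
      -κ - m.r i * d + 1 / 2 * ∑ l, m.a i l l - m.r i * barrier su κ T t s i := by
  have h₁ : deriv (fun τ => barrier su κ T τ s i) t = -κ := by
    have : HasDerivAt (fun τ => barrier su κ T τ s i) (κ * (-1)) t := by
      unfold barrier
      exact (((hasDerivAt_id t).const_sub T).const_mul κ).const_add _
    rw [this.deriv]
    ring
  have h₂ : ∀ l, s l * -(s l)⁻¹ = -1 := fun l => by
    have := (hs l).ne'
    field_simp
  have h₃ : ∀ l, m.a i l l * s l * s l * (s l ^ 2)⁻¹ = m.a i l l := fun l => by
    have := (hs l).ne'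
    field_simp
  have h₄ : ∑ j, m.rate i j * barrier su κ T t s j = 0 := by
    change ∑ j, m.rate i j * barrier su κ T t s i = 0
    rw [← Finset.sum_mul, m.rate_sum, zero_mul]
  simp only [Model.parabolic, Model.L, h₁, h₄, partialDeriv_barrier hs,
    partialDeriv_partialDeriv_barrier hs, h₂, mul_ite, mul_zero, Finset.sum_ite_eq,
    Finset.mem_univ, if_true, h₃]
  simp
  ring

end Barrier

/-! ### Geometry of the box and the minimum principle -/

section Box

variable {sb su s : Fin d → ℝ}

theorem isOpen_box : IsOpen (box sb su) :=
  isOpen_set_pi finite_univ fun _ _ => isOpen_Ioo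

theorem box_subset_orthant (hsb : ∀ l, 0 ≤ sb l) : box sb su ⊆ orthant d :=
  fun _ hs l => (hsb l).trans_lt (hs l (mem_univ l)).1

theorem closure_box (hsu : ∀ l, sb l < su l) : closure (box sb su) = Icc sb su := by
  rw [box, closure_pi_set, ← pi_univ_Icc]
  exact congrArg _ (funext fun l => closure_Ioo (hsu l).ne)

theorem box_subset_closure_inter_orthant (hsb : ∀ l, 0 ≤ sb l) :
    box sb su ⊆ closure (box sb su) ∩ orthant d :=
  subset_inter subset_closure (box_subset_orthant hsb)

theorem mem_box_or_mem_boxBoundary (hs : s ∈ closure (box sb su) ∩ orthant d) :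
    s ∈ box sb su ∨ s ∈ boxBoundary sb su := by
  by_cases h : s ∈ box sb su
  · exact Or.inl h
  · refine Or.inr ⟨⟨hs.1, ?_⟩, hs.2⟩
    rwa [isOpen_box.interior_eq]

theorem nonneg_of_nonneg_on_box (hsb : ∀ l, 0 ≤ sb l) {q : (Fin d → ℝ) → ℝ}
    (hq : ContinuousOn q (closure (box sb su) ∩ orthant d)) (h : ∀ s ∈ box sb su, 0 ≤ q s)
    (hs : s ∈ closure (box sb su) ∩ orthant d) : 0 ≤ q s :=
  ContinuousWithinAt.closure_le (f := fun _ => 0) hs.1 continuousWithinAt_const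
    ((hq s hs).mono (box_subset_closure_inter_orthant hsb)) h

/-- Minimum principle on `[t₀, T) × R` for supersolutions bounded below; no condition is imposed
where the closure of `R` meets the coordinate hyperplanes. -/
theorem nonneg_of_parabolic_nonpos (m : Model d k) {t₀ T : ℝ}
    (hsb : ∀ l, 0 ≤ sb l) (hsu : ∀ l, sb l < su l) {z : ℝ → (Fin d → ℝ) → Fin k → ℝ}
    (hcont : ∀ i, ContinuousOn (fun p : ℝ × (Fin d → ℝ) => z p.1 p.2 i)
      (Icc t₀ T ×ˢ (closure (box sb su) ∩ orthant d)))
    (hsmooth : ∀ t ∈ Ico t₀ T, ∀ s ∈ box sb su, IsSmoothAt z t s)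
    (hpar : ∀ t ∈ Ico t₀ T, ∀ s ∈ box sb su, ∀ i, m.parabolic z t s i ≤ 0)
    {B : ℝ} (hB : ∀ t ∈ Icc t₀ T, ∀ s ∈ closure (box sb su) ∩ orthant d, ∀ i, -B ≤ z t s i)
    (hterm : ∀ s ∈ closure (box sb su) ∩ orthant d, ∀ i, 0 ≤ z T s i)
    (hbdry : ∀ t ∈ Icc t₀ T, ∀ s ∈ boxBoundary sb su, ∀ i, 0 ≤ z t s i) :
    ∀ t ∈ Icc t₀ T, ∀ s ∈ box sb su, ∀ i, 0 ≤ z t s i := by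
  set D := closure (box sb su) ∩ orthant d with hD
  -- Large enough to beat half the trace of `a i` in every regime at once.
  set κ : ℝ := 1 + ∑ i, |1 / 2 * ∑ l, m.a i l l| with hκ
  have hκ' : ∀ i, 1 / 2 * ∑ l, m.a i l l < κ := fun i => by
    have := Finset.single_le_sum (f := fun i => |1 / 2 * ∑ l, m.a i l l|)
      (fun i _ => abs_nonneg _) (Finset.mem_univ i)
    have := le_abs_self (1 / 2 * ∑ l, m.a i l l)
    linarith
  have hκ0 : 0 ≤ κ := by positivity
  have hsupos : ∀ l, 0 < su l := fun l => (hsb l).trans_lt (hsu l)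
  have hDle : ∀ s ∈ D, ∀ l, sb l ≤ s l ∧ s l ≤ su l ∧ 0 < s l := fun s hs l => by
    have h := hs.1
    rw [closure_box hsu] at h
    exact ⟨h.1 l, h.2 l, hs.2 l⟩
  have hlog : ∀ s ∈ D, ∀ l, 0 ≤ Real.log (su l) - Real.log (s l) := fun s hs l =>
    sub_nonneg.2 (Real.log_le_log (hDle s hs l).2.2 (hDle s hs l).2.1)
  have hψl : ∀ t ≤ T, ∀ s ∈ D, ∀ (i : Fin k) l,
      Real.log (su l) - Real.log (s l) ≤ barrier su κ T t s i := fun t ht s hs i l => by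
    have h₁ := Finset.single_le_sum (f := fun l => Real.log (su l) - Real.log (s l))
      (fun l _ => hlog s hs l) (Finset.mem_univ l)
    have h₂ : 0 ≤ κ * (T - t) := mul_nonneg hκ0 (sub_nonneg.2 ht)
    simp only [barrier] at *
    linarith
  have hψ : ∀ t ≤ T, ∀ s ∈ D, ∀ i : Fin k, 0 ≤ barrier su κ T t s i := fun t ht s hs i =>
    add_nonneg (Finset.sum_nonneg fun l _ => hlog s hs l) (mul_nonneg hκ0 (sub_nonneg.2 ht))
  have key : ∀ ε > 0, ∀ t ∈ Icc t₀ T, ∀ s ∈ D, ∀ i, 0 ≤ z t s i + ε * barrier su κ T t s i := by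
    intro ε hε t₁ ht₁ s₁ hs₁ i₁
    by_contra! hneg
    set h : ℝ → (Fin d → ℝ) → Fin k → ℝ := fun t s i => z t s i + ε * barrier su κ T t s i
      with hh
    -- If some `s l < δ l`, then `ε * barrier > B`, which outweighs the lower bound `-B` of `z`.
    set δ : Fin d → ℝ := fun l => su l * Real.exp (-(B / ε)) with hδ
    have hδpos : ∀ l, 0 < δ l := fun l => mul_pos (hsupos l) (Real.exp_pos _)
    have hout : ∀ t ∈ Icc t₀ T, ∀ s ∈ D, ∀ i, h t s i < 0 → s ∈ Icc (sb ⊔ δ) su := by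
      intro t ht s hs i hlt
      refine ⟨sup_le (fun l => (hDle s hs l).1) fun l => ?_, fun l => (hDle s hs l).2.1⟩
      by_contra! hsl
      have h₁ : Real.log (s l) < Real.log (su l) - B / ε := by
        have := Real.log_lt_log (hDle s hs l).2.2 hsl
        rwa [Real.log_mul (hsupos l).ne' (Real.exp_pos _).ne', Real.log_exp,
          ← sub_eq_add_neg] at this
      have h₂ := hψl t ht.2 s hs i l
      have h₃ : B / ε < barrier su κ T t s i := by linarith
      rw [div_lt_iff₀ hε] at h₃
      have := hB t ht s hs i
      simp only [hh] at hlt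
      linarith
    have hKD : Icc (sb ⊔ δ) su ⊆ D := fun s hs => by
      refine ⟨?_, fun l => (hδpos l).trans_le (le_sup_right.trans (hs.1 l))⟩
      rw [closure_box hsu]
      exact ⟨le_sup_left.trans hs.1, hs.2⟩
    have hhcont : ∀ i, ContinuousOn (fun p : ℝ × (Fin d → ℝ) => h p.1 p.2 i) (Icc t₀ T ×ˢ D) := by
      intro i
      refine (hcont i).add (continuousOn_const.mul ?_)
      unfold barrier
      refine ContinuousOn.add (continuousOn_finsetSum _ fun l _ => continuousOn_const.sub ?_)
        (by fun_prop)
      exact ContinuousOn.log (by fun_prop) fun p hp => (hp.2.2 l).ne'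
    have hmin : ∀ i, ∃ p ∈ Icc t₀ T ×ˢ Icc (sb ⊔ δ) su,
        ∀ q ∈ Icc t₀ T ×ˢ Icc (sb ⊔ δ) su, h p.1 p.2 i ≤ h q.1 q.2 i := fun i =>
      (isCompact_Icc.prod isCompact_Icc).exists_isMinOn
        ⟨(t₁, s₁), ht₁, hout t₁ ht₁ s₁ hs₁ i₁ hneg⟩
        ((hhcont i).mono (prod_mono subset_rfl hKD))
    choose p hp hpmin using hmin
    have : Nonempty (Fin k) := ⟨i₁⟩
    obtain ⟨i, hi⟩ := Finite.exists_min fun i => h (p i).1 (p i).2 i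
    obtain ⟨⟨ht, hsK⟩, hs⟩ : ((p i).1 ∈ Icc t₀ T ∧ (p i).2 ∈ Icc (sb ⊔ δ) su) ∧ (p i).2 ∈ D :=
      ⟨hp i, hKD (hp i).2⟩
    generalize (p i).1 = t at *
    generalize (p i).2 = s at *
    have hle : ∀ t' ∈ Icc t₀ T, ∀ s' ∈ Icc (sb ⊔ δ) su, ∀ j, h t s i ≤ h t' s' j :=
      fun t' ht' s' hs' j => (hi j).trans (hpmin j (t', s') ⟨ht', hs'⟩)
    have hts : h t s i < 0 :=
      (hle t₁ ht₁ s₁ (hout t₁ ht₁ s₁ hs₁ i₁ hneg) i₁).trans_lt hneg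
    -- Off the compact box `h` is nonnegative, so its negative minimum there is global on `D`; in
    -- particular it is a local minimum in space.
    have hall : ∀ t' ∈ Icc t₀ T, ∀ s' ∈ D, ∀ j, h t s i ≤ h t' s' j := by
      intro t' ht' s' hs' j
      rcases lt_or_ge (h t' s' j) 0 with hlt | hge
      · exact hle t' ht' s' (hout t' ht' s' hs' j hlt) j
      · exact hts.le.trans hge
    have hψts : 0 ≤ ε * barrier su κ T t s i := mul_nonneg hε.le (hψ t ht.2 s hs i)
    have hz : z t s i < 0 := by
      simp only [hh] at hts
      linarith
    have htT : t < T := lt_of_le_of_ne ht.2 fun heq =>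
      hz.not_ge (heq ▸ hterm s hs i)
    have hsbox : s ∈ box sb su := (mem_box_or_mem_boxBoundary hs).resolve_right fun hΓ =>
      hz.not_ge (hbdry t ht s hΓ i)
    have hsmz := hsmooth t ⟨ht.1, htT⟩ s hsbox
    have hsmψ : IsSmoothAt (barrier (k := k) su κ T) t s := isSmoothAt_barrier hs.2
    have hge : 0 ≤ m.parabolic h t s i := by
      refine (hsmz.add (hsmψ.const_mul ε)).parabolic_nonneg m htT hts.le
        (fun τ hτ => hall τ ⟨ht.1.trans hτ.1.le, hτ.2.le⟩ s hs i) ?_ fun j => hall t ht s hs j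
      filter_upwards [isOpen_box.mem_nhds hsbox] with x hx
      exact hall t ht x (box_subset_closure_inter_orthant hsb hx) i
    have hlt : m.parabolic h t s i < 0 := by
      rw [hh, hsmz.parabolic_add m (hsmψ.const_mul ε), hsmψ.parabolic_const_mul m,
        parabolic_barrier m hs.2]
      have h₁ := hpar t ⟨ht.1, htT⟩ s hsbox i
      have h₂ : 0 ≤ m.r i * d := mul_nonneg (m.r_nonneg i) d.cast_nonneg
      have h₃ : 0 ≤ m.r i * barrier su κ T t s i := mul_nonneg (m.r_nonneg i) (hψ t ht.2 s hs i)
      have h₄ := hκ' i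
      have := mul_neg_of_pos_of_neg hε (show -κ - m.r i * d + 1 / 2 * ∑ l, m.a i l l -
        m.r i * barrier su κ T t s i < 0 by linarith)
      linarith
    exact hlt.not_ge hge
  intro t ht s hs i
  have hlim : Tendsto (fun ε : ℝ => z t s i + ε * barrier su κ T t s i) (𝓝[>] 0)
      (𝓝 (z t s i)) := by
    have : ContinuousAt (fun ε : ℝ => z t s i + ε * barrier su κ T t s i) 0 := by fun_prop
    simpa using this.tendsto.mono_left nhdsWithin_le_nhds
  refine ge_of_tendsto hlim ?_
  filter_upwards [self_mem_nhdsWithin] with ε hε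
  exact key ε hε t ht s (box_subset_closure_inter_orthant hsb hs) i

/-- The box is bounded, so linear growth supplies the bound near the hyperplanes that continuity
alone does not give. -/
theorem LinearGrowth.exists_bound (hsu : ∀ l, sb l < su l) {T : ℝ}
    {f : ℝ → (Fin d → ℝ) → Fin k → ℝ} (hf : LinearGrowth T (box sb su) f) :
    ∃ B, ∀ t ∈ Icc 0 T, ∀ s ∈ closure (box sb su) ∩ orthant d, ∀ i, |f t s i| ≤ B := by
  obtain ⟨c, hc⟩ := hf
  refine ⟨|c| * (1 + ∑ l, su l), fun t ht s hs i => (hc t ht s hs i).trans ?_⟩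
  have hle : ∑ l, |s l| ≤ ∑ l, su l := Finset.sum_le_sum fun l _ => by
    have h := hs.1
    rw [closure_box hsu] at h
    rw [abs_of_pos (hs.2 l)]
    exact h.2 l
  have h0 : 0 ≤ ∑ l, |s l| := Finset.sum_nonneg fun l _ => abs_nonneg _
  exact mul_le_mul (le_abs_self c) (by linarith) (by linarith) (abs_nonneg c)

/-- One-sided comparison of a bounded solution `u` with zero terminal data and a positive
supersolution `y`. -/
theorem nonneg_const_mul_add (m : Model d k) {t₀ T : ℝ} (ht₀ : t₀ ∈ Ioo 0 T)
    (hsb : ∀ l, 0 ≤ sb l) (hsu : ∀ l, sb l < su l) {u y : ℝ → (Fin d → ℝ) → Fin k → ℝ}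
    (hucont : ∀ i, ContinuousOn (fun p : ℝ × (Fin d → ℝ) => u p.1 p.2 i)
      (Icc 0 T ×ˢ (closure (box sb su) ∩ orthant d)))
    (hycont : ∀ i, ContinuousOn (fun p : ℝ × (Fin d → ℝ) => y p.1 p.2 i)
      (Icc 0 T ×ˢ (closure (box sb su) ∩ orthant d)))
    (husm : ∀ t ∈ Ioo 0 T, ∀ s ∈ box sb su, IsSmoothAt u t s)
    (hysm : ∀ t ∈ Ioo 0 T, ∀ s ∈ box sb su, IsSmoothAt y t s)
    (hu : ∀ t ∈ Ioo 0 T, ∀ s ∈ box sb su, ∀ i, m.parabolic u t s i = 0)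
    (hy : ∀ t ∈ Ioo 0 T, ∀ s ∈ box sb su, ∀ i, m.parabolic y t s i ≤ 0)
    {B : ℝ} (hB : ∀ t ∈ Icc 0 T, ∀ s ∈ closure (box sb su) ∩ orthant d, ∀ i, -B ≤ u t s i)
    (huT : ∀ s ∈ box sb su, ∀ i, u T s i = 0)
    (hypos : ∀ t ∈ Icc 0 T, ∀ s ∈ box sb su, ∀ i, 0 ≤ y t s i) {M : ℝ} (hM : 0 ≤ M)
    (hbdry : ∀ t ∈ Ioo t₀ T, ∀ s ∈ boxBoundary sb su, ∀ i, 0 ≤ M * y t s i + u t s i) :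
    ∀ s ∈ box sb su, ∀ i, 0 ≤ M * y t₀ s i + u t₀ s i := by
  have hsub : ∀ {t : ℝ}, t ∈ Icc t₀ T → t ∈ Icc 0 T := fun h => ⟨ht₀.1.le.trans h.1, h.2⟩
  have hsub' : ∀ {t : ℝ}, t ∈ Ico t₀ T → t ∈ Ioo 0 T := fun h => ⟨ht₀.1.trans_le h.1, h.2⟩
  have hcont : ∀ i, ContinuousOn (fun p : ℝ × (Fin d → ℝ) => M * y p.1 p.2 i + u p.1 p.2 i)
      (Icc 0 T ×ˢ (closure (box sb su) ∩ orthant d)) := fun i =>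
    (continuousOn_const.mul (hycont i)).add (hucont i)
  have hslice : ∀ {q : ℝ × (Fin d → ℝ) → ℝ},
      ContinuousOn q (Icc 0 T ×ˢ (closure (box sb su) ∩ orthant d)) → ∀ t ∈ Icc 0 T,
      ContinuousOn (fun s => q (t, s)) (closure (box sb su) ∩ orthant d) :=
    fun hq t ht => hq.comp (by fun_prop) fun s hs => ⟨ht, hs⟩
  have hyD : ∀ t ∈ Icc 0 T, ∀ s ∈ closure (box sb su) ∩ orthant d, ∀ i, 0 ≤ y t s i :=
    fun t ht s hs i => nonneg_of_nonneg_on_box (q := fun s => y t s i) hsb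
      (hslice (hycont i) t ht) (fun s hs => hypos t ht s hs i) hs
  have hT : T ∈ Icc 0 T := ⟨ht₀.1.le.trans ht₀.2.le, le_rfl⟩
  refine nonneg_of_parabolic_nonpos (z := fun t s i => M * y t s i + u t s i) (B := B) m hsb hsu
    (fun i => (hcont i).mono (prod_mono (fun t ht => hsub ht) subset_rfl))
    (fun t ht s hs => ((hysm t (hsub' ht) s hs).const_mul M).add (husm t (hsub' ht) s hs))
    ?_ ?_ ?_ ?_ t₀ ⟨le_rfl, ht₀.2.le⟩
  · intro t ht s hs i
    have hys := hysm t (hsub' ht) s hs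
    rw [(hys.const_mul M).parabolic_add m (husm t (hsub' ht) s hs), hys.parabolic_const_mul m,
      hu t (hsub' ht) s hs i, add_zero]
    exact mul_nonpos_of_nonneg_of_nonpos hM (hy t (hsub' ht) s hs i)
  · intro t ht s hs i
    have h₁ := hB t (hsub ht) s hs i
    have h₂ := mul_nonneg hM (hyD t (hsub ht) s hs i)
    linarith
  · intro s hs i
    refine nonneg_of_nonneg_on_box (q := fun s => M * y T s i + u T s i) hsb
      (hslice (hcont i) T hT) (fun s hs => ?_) hs
    rw [huT s hs i, add_zero]
    exact mul_nonneg hM (hypos T hT s hs i)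
  · intro t ht s hs i
    have hsD : s ∈ closure (box sb su) ∩ orthant d := ⟨frontier_subset_closure hs.1, hs.2⟩
    -- The boundary inequality is known on the open time interval only; continuity in time carries
    -- it to both endpoints.
    have hq : ContinuousOn (fun τ => M * y τ s i + u τ s i) (Icc t₀ T) :=
      (hcont i).comp (f := fun τ : ℝ => (τ, s)) (by fun_prop) fun τ hτ => ⟨hsub hτ, hsD⟩
    refine ContinuousWithinAt.closure_le (f := fun _ => 0)
      (g := fun τ => M * y τ s i + u τ s i) (s := Ioo t₀ T) (x := t) ?_
      continuousWithinAt_const ((hq t ht).mono Ioo_subset_Icc_self)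
      fun τ hτ => hbdry τ hτ s hs i
    rwa [closure_Ioo ht₀.2.ne]

end Box

end RegimeSwitching

open RegimeSwitching in
theorem theorem4p6 {d k : ℕ} (m : RegimeSwitching.Model d k) (T : ℝ) (hT : 0 < T)
    (sb su : Fin d → ℝ) (hsb : ∀ l, 0 ≤ sb l) (hsu : ∀ l, sb l < su l)
    (K : (Fin d → ℝ) → ℝ)
    (v w : ℝ → (Fin d → ℝ) → Fin k → ℝ)
    (hv : m.IsSolution T (RegimeSwitching.box sb su) K v)
    (hw : m.IsSolution T (RegimeSwitching.box sb su) K w)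
    (C : Fin d → ℝ) (hC : ∀ l, 0 ≤ C l)
    (yl : Fin d → ℝ → (Fin d → ℝ) → Fin k → ℝ)
    (hyl : ∀ l, RegimeSwitching.IsClassical T (RegimeSwitching.box sb su) (yl l))
    (hsuper : ∀ l, ∀ t ∈ Ioo 0 T, ∀ s ∈ RegimeSwitching.box sb su, ∀ i,
      m.parabolic (yl l) t s i ≤ 0)
    (y : ℝ → (Fin d → ℝ) → Fin k → ℝ)
    (hy : ∀ t s i, y t s i = ∑ l, C l * yl l t s i)
    (hpos : ∀ t ∈ Icc 0 T, ∀ s ∈ RegimeSwitching.box sb su, ∀ i, 0 < y t s i) :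
    ∀ t ∈ Ioo 0 T, ∀ s ∈ RegimeSwitching.box sb su, ∀ i,
      ENNReal.ofReal |v t s i - w t s i| ≤
        (⨆ t' ∈ Ioo t T, ⨆ s' ∈ RegimeSwitching.boxBoundary sb su, ⨆ i' : Fin k,
          ENNReal.ofReal |v t' s' i' - w t' s' i'| / ENNReal.ofReal (y t' s' i')) *
        ENNReal.ofReal (y t s i) := by
  intro t₀ ht₀ s₀ hs₀ i₀
  obtain rfl : y = fun t s i => ∑ l, C l * yl l t s i := by
    funext t s i
    exact hy t s i
  set y : ℝ → (Fin d → ℝ) → Fin k → ℝ := fun t s i => ∑ l, C l * yl l t s i with hydef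
  set M := ⨆ t' ∈ Ioo t₀ T, ⨆ s' ∈ boxBoundary sb su, ⨆ i' : Fin k,
    ENNReal.ofReal |v t' s' i' - w t' s' i'| / ENNReal.ofReal (y t' s' i') with hMdef
  have hypos₀ : 0 < y t₀ s₀ i₀ := hpos t₀ ⟨ht₀.1.le, ht₀.2.le⟩ s₀ hs₀ i₀
  rcases eq_or_ne M ⊤ with hM | hM
  · rw [hM, ENNReal.top_mul (by simpa using hypos₀)]
    exact le_top
  have hysm : ∀ t ∈ Ioo 0 T, ∀ s ∈ box sb su, IsSmoothAt y t s := fun t ht s hs =>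
    isSmoothAt_sum _ fun l _ => ((hyl l).isSmoothAt isOpen_box ht hs).const_mul (C l)
  have hypar : ∀ t ∈ Ioo 0 T, ∀ s ∈ box sb su, ∀ i, m.parabolic y t s i ≤ 0 :=
    fun t ht s hs i => parabolic_sum_nonpos m _
      (fun l _ => ((hyl l).isSmoothAt isOpen_box ht hs).const_mul (C l)) i fun l _ => by
        rw [((hyl l).isSmoothAt isOpen_box ht hs).parabolic_const_mul m]
        exact mul_nonpos_of_nonneg_of_nonpos (hC l) (hsuper l t ht s hs i)
  have hycont : ∀ i, ContinuousOn (fun p : ℝ × (Fin d → ℝ) => y p.1 p.2 i)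
      (Icc 0 T ×ˢ (closure (box sb su) ∩ orthant d)) := fun i =>
    continuousOn_finsetSum _ fun l _ => continuousOn_const.mul ((hyl l).continuousOn i)
  have hΓ : ∀ t ∈ Ioo t₀ T, ∀ s ∈ boxBoundary sb su, ∀ i,
      |v t s i - w t s i| ≤ M.toReal * y t s i := by
    intro t ht s hs i
    have htI : t ∈ Icc 0 T := ⟨ht₀.1.le.trans ht.1.le, ht.2.le⟩
    have hy0 : 0 ≤ y t s i := nonneg_of_nonneg_on_box (q := fun s => y t s i) hsb
      ((hycont i).comp (f := fun s => (t, s)) (by fun_prop) fun s hs => ⟨htI, hs⟩)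
      (fun s hs => (hpos t htI s hs i).le) ⟨frontier_subset_closure hs.1, hs.2⟩
    have h : ENNReal.ofReal |v t s i - w t s i| / ENNReal.ofReal (y t s i) ≤ M :=
      le_iSup₂_of_le t ht (le_iSup₂_of_le s hs (le_iSup_of_le i le_rfl))
    -- Valid even where `y = 0`: a finite `M` excludes `a / 0 = ∞`, so the numerator vanishes there.
    rwa [ENNReal.div_le_iff_le_mul (Or.inr hM) (Or.inl ENNReal.ofReal_ne_top),
      ← ENNReal.ofReal_toReal hM, ← ENNReal.ofReal_mul ENNReal.toReal_nonneg,
      ENNReal.ofReal_le_ofReal_iff (mul_nonneg ENNReal.toReal_nonneg hy0)] at h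
  -- Stated for arbitrary solutions so that exchanging `v` and `w` yields both halves of the
  -- absolute value.
  have hcomp : ∀ {v w : ℝ → (Fin d → ℝ) → Fin k → ℝ}, m.IsSolution T (box sb su) K v →
      m.IsSolution T (box sb su) K w → (∀ t ∈ Ioo t₀ T, ∀ s ∈ boxBoundary sb su, ∀ i,
        |v t s i - w t s i| ≤ M.toReal * y t s i) →
      w t₀ s₀ i₀ - v t₀ s₀ i₀ ≤ M.toReal * y t₀ s₀ i₀ := by
    intro v w hv hw hvw
    obtain ⟨Bv, hBv⟩ := hv.growth.exists_bound hsu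
    obtain ⟨Bw, hBw⟩ := hw.growth.exists_bound hsu
    have hvsm := fun t ht s hs => hv.classical.isSmoothAt (t := t) (s := s) isOpen_box ht hs
    have hwsm := fun t ht s hs => hw.classical.isSmoothAt (t := t) (s := s) isOpen_box ht hs
    have := nonneg_const_mul_add (u := fun t s i => v t s i + (-1) * w t s i) (y := y)
      (B := Bv + Bw) (M := M.toReal) m ht₀ hsb hsu
      (fun i => (hv.classical.continuousOn i).add
        (continuousOn_const.mul (hw.classical.continuousOn i))) hycont
      (fun t ht s hs => (hvsm t ht s hs).add ((hwsm t ht s hs).const_mul (-1))) hysm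
      (fun t ht s hs i => by
        rw [(hvsm t ht s hs).parabolic_add m ((hwsm t ht s hs).const_mul (-1)),
          (hwsm t ht s hs).parabolic_const_mul m, hv.pde t ht s hs i, hw.pde t ht s hs i]
        simp) hypar
      (fun t ht s hs i => by
        have h₁ := abs_le.1 (hBv t ht s hs i)
        have h₂ := abs_le.1 (hBw t ht s hs i)
        linarith [h₁.1, h₂.2])
      (fun s hs i => by
        rw [hv.terminal s hs i, hw.terminal s hs i]
        ring)
      (fun t ht s hs i => (hpos t ht s hs i).le) ENNReal.toReal_nonneg
      (fun t ht s hs i => by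
        have := abs_le.1 (hvw t ht s hs i)
        linarith [this.1]) s₀ hs₀ i₀
    linarith
  rw [← ENNReal.ofReal_toReal hM, ← ENNReal.ofReal_mul ENNReal.toReal_nonneg]
  refine ENNReal.ofReal_le_ofReal (abs_sub_le_iff.2 ⟨?_, hcomp hv hw hΓ⟩)
  exact hcomp hw hv fun t ht s hs i => by
    rw [abs_sub_comm]
    exact hΓ t ht s hs i
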